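/- Write $\mathscr{D}(\mathbb{R}^d)$ for the space of complex-valued smooth compactly supported functions on $\mathbb{R}^d$, $\mathscr{D}'(\mathbb{R}^d)$ for the space of distributions (continuous $\mathbb{C}$-linear functionals on $\mathscr{D}(\mathbb{R}^d)$), $P(D)=P(-i\partial_1,\ldots,-i\partial_d)$ and $\delta_\xi$ for the Dirac distribution at $\xi$. For $M\subseteq\mathbb{R}^d$ compact, $N\in\mathbb{N}=\{0,1,2,\ldots\}$ and $E\in\mathscr{D}'(\mathbb{R}^d)$ set $$\|E\|^*_{M,N}=\sup\Big\{|\langle E,\varphi\rangle| \;:\; \varphi\in\mathscr{D}(\mathbb{R}^d),\ \operatorname{supp}\varphi\subseteq M,\ \sup_{x\in M,\,|\alpha|\le N}|\partial^\alpha\varphi(x)|\le 1\Big\}\in[0,\infty].$$ Let $P\in\mathbb{C}[\xi_1,\ldots,\xi_d]\setminus\{0\}$, let $K\subseteq\mathbb{R}^d$ be compact and convex, and let $\xi\in\mathbb{R}^d$ with $\xi\notin K$. Then there is a family $(E_{\xi,\varepsilon})_{\varepsilon\in(0,1)}$ in $\mathscr{D}'(\mathbb{R}^d)$ such that, for all $\varepsilon\in(0,1)$,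 $$P(D)E_{\xi,\varepsilon}=\delta_\xi \text{ in } \mathbb{R}^d \qquad\text{and}\qquad \|E_{\xi,\varepsilon}\|^*_{K,d+1}\le\varepsilon,$$ and such that for every compact convex $L\subseteq\mathbb{R}^d$ there are $s,C>0$ (independent of $\varepsilon$) with $$\|E_{\xi,\varepsilon}\|^*_{L,d+1}\le\frac{C}{\varepsilon^{s}}\qquad\text{for all }\varepsilon\in(0,1).$$ -/

import Mathlib

open scoped ENNReal Distributions

namespace ShiftedFS

/-- The space `ℝ^d` with its Euclidean structure. -/
abbrev Rd (d : ℕ) : Type := EuclideanSpace ℝ (Fin d)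

/-- `𝒟(ℝ^d)`: complex-valued smooth compactly supported functions on `ℝ^d`, with Mathlib's
canonical (LF) topology. -/
abbrev TestFun (d : ℕ) : Type := 𝓓((⊤ : TopologicalSpace.Opens (Rd d)), ℂ)

/-- `𝒟'(ℝ^d)`: continuous `ℂ`-linear functionals on the complex-valued test functions.
(Mathlib's `Distribution` tests against real-valued functions only, whereas the dual norms below
are suprema over complex-valued test functions.) -/
abbrev Distr (d : ℕ) : Type := TestFun d →L[ℂ] ℂ

/-- The partial derivative `∂_j` on test functions. -/
noncomputable def partialDeriv {d : ℕ} (j : Fin d) : TestFun d →L[ℂ] TestFun d :=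
  TestFunction.lineDerivCLM ℂ (EuclideanSpace.single j (1 : ℝ))

/-- `∂^α = ∂_1^{α_1} ⋯ ∂_d^{α_d}` on test functions. -/
noncomputable def multiDeriv {d : ℕ} (α : Fin d →₀ ℕ) : TestFun d →L[ℂ] TestFun d :=
  ((List.finRange d).map fun j => partialDeriv j ^ α j).prod

/-- `D_j = -i ∂_j` on distributions, where `⟨∂_j E, φ⟩ = -⟨E, ∂_j φ⟩`. -/
noncomputable def distD {d : ℕ} (j : Fin d) : Module.End ℂ (Distr d) where
  toFun E := (-Complex.I) • (-(E ∘L partialDeriv j))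
  map_add' E F := by ext φ; simp; ring
  map_smul' c E := by ext φ; simp; ring

/-- `D^α = D_1^{α_1} ⋯ D_d^{α_d}` on distributions. -/
noncomputable def distMultiD {d : ℕ} (α : Fin d →₀ ℕ) : Module.End ℂ (Distr d) :=
  ((List.finRange d).map fun j => distD j ^ α j).prod

/-- `P(D) = ∑_α c_α D^α` on distributions, for `P = ∑_α c_α X^α`. -/
noncomputable def polyD {d : ℕ} (P : MvPolynomial (Fin d) ℂ) : Module.End ℂ (Distr d) :=
  ∑ α ∈ P.support, P.coeff α • distMultiD α

/-- The Dirac distribution `δ_ξ`. -/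
noncomputable def dirac {d : ℕ} (ξ : Rd d) : Distr d where
  toFun φ := φ ξ
  map_add' _ _ := rfl
  map_smul' _ _ := rfl
  cont := continuous_eval_const _

/-- `‖φ‖_{K,N} = sup_{x ∈ K, |α| ≤ N} |∂^α φ(x)|`. -/
noncomputable def cnorm {d : ℕ} (K : Set (Rd d)) (N : ℕ) (φ : TestFun d) : ℝ≥0∞ :=
  ⨆ x ∈ K, ⨆ (α : Fin d →₀ ℕ) (_ : ∑ j, α j ≤ N), ‖multiDeriv α φ x‖ₑ

/-- `‖E‖*_{K,N} = sup {|⟨E, φ⟩| : φ ∈ 𝒟(ℝ^d), supp φ ⊆ K, ‖φ‖_{K,N} ≤ 1} ∈ [0, ∞]`. -/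
noncomputable def dualNorm {d : ℕ} (K : Set (Rd d)) (N : ℕ) (E : Distr d) : ℝ≥0∞ :=
  ⨆ (φ : TestFun d) (_ : tsupport φ ⊆ K) (_ : cnorm K N φ ≤ 1), ‖E φ‖ₑ

end ShiftedFS

/-!
The proof uses the explicit fundamental solutions of Malgrange–Ehrenpreis type due to Wagner. Let
`m` be the degree of `P`, and let `Φ(θ) = ∫ φ(x) exp(i θ·(x - ξ)) dx` be the Fourier–Laplace
transform of a test function `φ`, centred at `ξ`. For real `s`, pairing `φ` with the quotient
`conj P(θ) / P(θ)` along the frequencies `θ = 2πω - i s`, `ω ∈ ℝ^d`, is a distribution (`phaseDistr`).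
Applying `P(D)` to it multiplies `Φ` by `P(θ)`, which leaves `conj P(θ)`. On this frequency space
conjugation is the translation `θ ↦ θ + 2 i s`, so `conj P(θ)` is the polynomial `P̄(θ + 2 i s)`, where
`P̄` has the conjugate coefficients, and Fourier inversion yields a differential operator
`P̄(T + 2 i s)`, `T = i∂`, applied to `φ` and evaluated at `ξ` (`phaseDistr_transposePolyD`). For
`s = (t + k) η` with `k = 0, …, m`, the result is a polynomial of degree at most `m` in `t + k`; an
`m`-th finite difference in `k` extracts its top coefficient, the principal part of `P̄` at `2 i η`
times `φ(ξ)` (`sum_diffWeight_mul_eval_line`). Dividing by that number gives `P(D) E = δ_ξ`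
(`polyD_shiftedSol`).

The quotient has modulus at most `1`, and integrability of `Φ` over `ω` needs only `d + 1`
derivatives of `φ`, with constants that do not depend on `s`, apart from the supremum of
`exp(s·(x - ξ))` over the support (`norm_laplace_le_decay`). If `η·(x - ξ) ≤ -c < 0` on `K`, the dual
norm over `K` is therefore `O(exp(-c t))`, while over any compact `L` it is `O(exp(b t))` for some `b`
(`dualNorm_shiftedSol_le`). A direction `η` that separates `K` from `ξ` and is not a zero of the
principal part exists because separation is an open condition (`exists_separating_direction`).
Taking `t` proportional to `log(1/ε)`, up to a constant, gives both estimates.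
-/

namespace ShiftedFS

open MeasureTheory

/-! ### Polynomials along lines -/

/-- The restriction `t ↦ Q(θ + t v)` of `Q` to a complex line, as a polynomial in `t`. -/
noncomputable def lineRestrict {d : ℕ} (θ v : Fin d → ℂ) (Q : MvPolynomial (Fin d) ℂ) :
    Polynomial ℂ :=
  MvPolynomial.aeval (fun j => Polynomial.C (θ j) + Polynomial.C (v j) * Polynomial.X) Q

lemma eval_lineRestrict {d : ℕ} (θ v : Fin d → ℂ) (Q : MvPolynomial (Fin d) ℂ) (t : ℂ) :
    (lineRestrict θ v Q).eval t = MvPolynomial.eval (fun j => θ j + v j * t) Q := by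
  unfold lineRestrict
  have h : (Polynomial.evalRingHom t).comp (MvPolynomial.aeval (R := ℂ) (fun j =>
        Polynomial.C (θ j) + Polynomial.C (v j) * Polynomial.X)).toRingHom =
      MvPolynomial.eval (fun j => θ j + v j * t) := by
    apply MvPolynomial.ringHom_ext <;> simp
  exact congrArg (fun f => f Q) h

lemma natDegree_prod_pow_le_and_coeff {d : ℕ} (θ v : Fin d → ℂ) (α : Fin d → ℕ)
    (s : Finset (Fin d)) :
    (∏ j ∈ s, (Polynomial.C (θ j) + Polynomial.C (v j) * Polynomial.X) ^ α j).natDegree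
        ≤ ∑ j ∈ s, α j ∧
      (∏ j ∈ s, (Polynomial.C (θ j) + Polynomial.C (v j) * Polynomial.X) ^ α j).coeff
        (∑ j ∈ s, α j) = ∏ j ∈ s, v j ^ α j := by
  classical
  have h1 (j : Fin d) :
      (Polynomial.C (θ j) + Polynomial.C (v j) * Polynomial.X).natDegree ≤ 1 := by
    compute_degree
  have hp (j : Fin d) :
      ((Polynomial.C (θ j) + Polynomial.C (v j) * Polynomial.X) ^ α j).natDegree ≤ α j := by
    simpa using Polynomial.natDegree_pow_le_of_le (α j) (h1 j)
  induction s using Finset.induction_on with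
  | empty => simp
  | insert a s ha ih =>
    rw [Finset.prod_insert ha, Finset.sum_insert ha, Finset.prod_insert ha]
    refine ⟨Polynomial.natDegree_mul_le.trans (add_le_add (hp a) ih.1), ?_⟩
    rw [Polynomial.coeff_mul_add_eq_of_natDegree_le (hp a) ih.1, ih.2]
    congr 1
    have := Polynomial.coeff_pow_of_natDegree_le (h1 a) (m := α a)
    rw [mul_one] at this
    rw [this]
    simp

lemma lineRestrict_eq_sum {d : ℕ} (θ v : Fin d → ℂ) (Q : MvPolynomial (Fin d) ℂ) :
    lineRestrict θ v Q = ∑ α ∈ Q.support, Polynomial.C (Q.coeff α) *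
      ∏ j, (Polynomial.C (θ j) + Polynomial.C (v j) * Polynomial.X) ^ α j := by
  rw [lineRestrict, MvPolynomial.aeval_eq_eval₂Hom, MvPolynomial.coe_eval₂Hom,
    MvPolynomial.eval₂_eq']
  rfl

lemma degree_le_totalDegree {d : ℕ} {Q : MvPolynomial (Fin d) ℂ} {α : Fin d →₀ ℕ}
    (hα : α ∈ Q.support) : ∑ j, α j ≤ Q.totalDegree := by
  have := MvPolynomial.le_totalDegree hα
  rwa [Finsupp.sum_fintype _ _ (fun _ => rfl)] at this

lemma natDegree_lineRestrict_le {d : ℕ} (θ v : Fin d → ℂ) (Q : MvPolynomial (Fin d) ℂ) :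
    (lineRestrict θ v Q).natDegree ≤ Q.totalDegree := by
  rw [lineRestrict_eq_sum]
  refine Polynomial.natDegree_sum_le_of_forall_le _ _ fun α hα => ?_
  refine (Polynomial.natDegree_C_mul_le _ _).trans ?_
  exact (natDegree_prod_pow_le_and_coeff θ v α _).1.trans (degree_le_totalDegree hα)

/-- The top coefficient of `t ↦ Q(θ + t v)` is the principal part of `Q` at the direction `v`;
in particular it does not depend on the base point `θ`. -/
lemma coeff_totalDegree_lineRestrict {d : ℕ} (θ v : Fin d → ℂ) (Q : MvPolynomial (Fin d) ℂ) :
    (lineRestrict θ v Q).coeff Q.totalDegree =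
      MvPolynomial.eval v (MvPolynomial.homogeneousComponent Q.totalDegree Q) := by
  rw [lineRestrict_eq_sum, Polynomial.finsetSum_coeff, MvPolynomial.homogeneousComponent_apply,
    map_sum, Finset.sum_filter]
  refine Finset.sum_congr rfl fun α hα => ?_
  obtain ⟨h1, h2⟩ := natDegree_prod_pow_le_and_coeff θ v α Finset.univ
  rw [Polynomial.coeff_C_mul, Finsupp.degree_eq_sum]
  split_ifs with h
  · rw [← h, h2, MvPolynomial.eval_monomial, Finsupp.prod_fintype _ _ (fun _ => pow_zero _)]
  · rw [Polynomial.coeff_eq_zero_of_natDegree_lt, mul_zero]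
    exact h1.trans_lt (lt_of_le_of_ne (degree_le_totalDegree hα) h)

lemma homogeneousComponent_totalDegree_ne_zero {d : ℕ} {Q : MvPolynomial (Fin d) ℂ}
    (hQ : Q ≠ 0) : MvPolynomial.homogeneousComponent Q.totalDegree Q ≠ 0 := by
  obtain ⟨α, hα, h⟩ := Finset.exists_mem_eq_sup Q.support
    (by simpa [Finset.nonempty_iff_ne_empty] using hQ) (fun s => s.sum fun _ e => e)
  intro h0
  have := MvPolynomial.coeff_homogeneousComponent Q.totalDegree α (φ := Q)
  rw [h0, if_pos (by rw [MvPolynomial.totalDegree, h, Finsupp.degree]; rfl)] at this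
  exact MvPolynomial.mem_support_iff.1 hα this.symm

/-- The weights of the normalized `m`-th forward difference: applied to the values of a polynomial
of degree at most `m` at `y, y + 1, …, y + m`, they return its coefficient of degree `m`. -/
noncomputable def diffWeight (m k : ℕ) : ℂ := (-1) ^ (m - k) * m.choose k / m.factorial

lemma sum_diffWeight_mul_eval (p : Polynomial ℂ) (m : ℕ) (h : p.natDegree ≤ m) (y : ℂ) :
    ∑ k ∈ Finset.range (m + 1), diffWeight m k * p.eval (y + k) = p.coeff m := by
  have key : (fwdDiff (1 : ℂ))^[m] p.eval y = p.coeff m * m.factorial := by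
    rcases h.lt_or_eq with h | rfl
    · rw [Polynomial.fwdDiff_iter_eq_zero_of_degree_lt h,
        Polynomial.coeff_eq_zero_of_natDegree_lt h]
      simp
    · rw [Polynomial.fwdDiff_iter_degree_eq_factorial]
      simp
  rw [fwdDiff_iter_eq_sum_shift] at key
  have h0 : (m.factorial : ℂ) ≠ 0 := by exact_mod_cast m.factorial_ne_zero
  rw [← mul_left_inj' h0, ← key, Finset.sum_mul]
  refine Finset.sum_congr rfl fun k _ => ?_
  simp [diffWeight]
  field_simp

lemma sum_diffWeight_mul_eval_line {d : ℕ} (Q : MvPolynomial (Fin d) ℂ) (θ v : Fin d → ℂ)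
    (y : ℂ) :
    ∑ k ∈ Finset.range (Q.totalDegree + 1),
        diffWeight Q.totalDegree k * MvPolynomial.eval (fun j => θ j + v j * (y + k)) Q =
      MvPolynomial.eval v (MvPolynomial.homogeneousComponent Q.totalDegree Q) := by
  simp_rw [← eval_lineRestrict]
  rw [sum_diffWeight_mul_eval _ _ (natDegree_lineRestrict_le θ v Q),
    coeff_totalDegree_lineRestrict]

lemma eval_conj_map_conj {d : ℕ} (P : MvPolynomial (Fin d) ℂ) (θ : Fin d → ℂ) :
    MvPolynomial.eval (fun j => starRingEnd ℂ (θ j)) (MvPolynomial.map (starRingEnd ℂ) P) =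
      starRingEnd ℂ (MvPolynomial.eval θ P) := by
  rw [MvPolynomial.eval_map, MvPolynomial.eval, MvPolynomial.coe_eval₂Hom, MvPolynomial.hom_eval₂]
  rfl

/-! ### A separating, non-characteristic direction -/

/-- A point outside a compact convex set can be strictly separated from it by a direction `η` at
which a given nonzero polynomial does not vanish, because the separating directions form an open
set. -/
lemma exists_separating_direction {d : ℕ} {Q : MvPolynomial (Fin d) ℂ} (hQ : Q ≠ 0)
    {K : Set (Rd d)} (hK : IsCompact K) (hKc : Convex ℝ K) {ξ : Rd d} (hξ : ξ ∉ K) :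
    ∃ η : Fin d → ℝ, MvPolynomial.eval (fun j => 2 * Complex.I * η j) Q ≠ 0 ∧
      ∃ c > 0, ∀ x ∈ K, ∑ j, η j * (x j - ξ j) ≤ -c := by
  obtain ⟨f, u, hfu, huξ⟩ := geometric_hahn_banach_closed_point hKc hK.isClosed hξ
  set η₀ : Fin d → ℝ := fun j => f (EuclideanSpace.single j 1) with hη₀
  have hf (x : Rd d) : f x = ∑ j, η₀ j * x j := by
    conv_lhs => rw [← (EuclideanSpace.basisFun (Fin d) ℝ).sum_repr x]
    simp [hη₀, mul_comm]
  set c : ℝ := (f ξ - u) / 2 with hc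
  have hcpos : 0 < c := by rw [hc]; linarith
  obtain ⟨R, hR⟩ := hK.isBounded.exists_norm_le
  set B : ℝ := |R| + ‖ξ‖ + 1 with hB
  have hBpos : 0 < B := by positivity
  set δ : ℝ := c / ((d + 1) * B) with hδ
  have hδpos : 0 < δ := by positivity
  have hinf (j : Fin d) :
      ((fun t : ℝ => 2 * Complex.I * (t : ℂ)) '' Set.Icc (η₀ j) (η₀ j + δ)).Infinite := by
    refine (Set.Icc_infinite (by linarith)).image ?_
    intro a _ b _ hab
    simpa [Complex.I_ne_zero] using hab
  have hex : ∃ z ∈ Set.pi Set.univ (fun j : Fin d =>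
      (fun t : ℝ => 2 * Complex.I * (t : ℂ)) '' Set.Icc (η₀ j) (η₀ j + δ)),
      MvPolynomial.eval z Q ≠ 0 := by
    by_contra! hcon
    exact hQ (MvPolynomial.funext_set _ hinf (by simpa using hcon))
  obtain ⟨z, hz, hzQ⟩ := hex
  choose η hη hηz using fun j => hz j (Set.mem_univ j)
  refine ⟨η, ?_, c, hcpos, fun x hx => ?_⟩
  · rwa [funext hηz]
  · have hbound (j : Fin d) : |x j - ξ j| ≤ B := by
      have h1 := PiLp.norm_apply_le x j
      have h2 := PiLp.norm_apply_le ξ j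
      rw [Real.norm_eq_abs] at h1 h2
      have h3 := hR x hx
      have h4 := abs_sub (x j) (ξ j)
      have := le_abs_self R
      linarith
    have hsplit : ∑ j, η j * (x j - ξ j) =
        (f x - f ξ) + ∑ j, (η j - η₀ j) * (x j - ξ j) := by
      rw [hf, hf, ← Finset.sum_sub_distrib, ← Finset.sum_add_distrib]
      exact Finset.sum_congr rfl fun j _ => by ring
    have hle : ∑ j, (η j - η₀ j) * (x j - ξ j) ≤ ∑ _j : Fin d, δ * B := by
      refine Finset.sum_le_sum fun j _ => ?_
      refine (le_abs_self _).trans ?_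
      rw [abs_mul]
      refine mul_le_mul ?_ (hbound j) (abs_nonneg _) hδpos.le
      rw [abs_le]
      constructor <;> linarith [(hη j).1, (hη j).2]
    have hle2 : ∑ _j : Fin d, δ * B ≤ c := by
      rw [Finset.sum_const, Finset.card_univ, Fintype.card_fin, nsmul_eq_mul]
      have : (d + 1 : ℝ) * (δ * B) = c := by rw [hδ]; field_simp
      nlinarith [mul_pos hδpos hBpos]
    have := hfu x hx
    rw [hsplit]
    linarith

/-! ### The Fourier–Laplace transform of test functions -/

lemma partialDeriv_apply {d : ℕ} (j : Fin d) (φ : TestFun d) (x : Rd d) :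
    partialDeriv j φ x = fderiv ℝ φ x (EuclideanSpace.single j 1) := by
  rw [partialDeriv, TestFunction.lineDerivCLM_eq_fderivCLM,
    TestFunction.fderivCLM_apply_of_le _ (by simp)]

lemma tsupport_partialDeriv_subset {d : ℕ} (j : Fin d) (φ : TestFun d) :
    tsupport (partialDeriv j φ) ⊆ tsupport φ := by
  have : (partialDeriv j φ : Rd d → ℂ) = fun x => fderiv ℝ φ x (EuclideanSpace.single j 1) :=
    funext (partialDeriv_apply j φ)
  rw [this]
  exact tsupport_fderiv_apply_subset ℝ _

lemma tsupport_partialDeriv_pow_subset {d : ℕ} (j : Fin d) (n : ℕ) (φ : TestFun d) :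
    tsupport ((partialDeriv j ^ n) φ) ⊆ tsupport φ := by
  induction n with
  | zero => simp
  | succ n ih =>
    rw [pow_succ']
    exact (tsupport_partialDeriv_subset j _).trans ih

/-- The exponential `x ↦ exp(i θ·(x - ξ))` with complex frequency `θ`, centred at `ξ`. -/
noncomputable def expKernel {d : ℕ} (ξ : Rd d) (θ : Fin d → ℂ) (x : Rd d) : ℂ :=
  Complex.exp (Complex.I * ∑ j, θ j * ((x j - ξ j : ℝ) : ℂ))

lemma contDiff_expKernel {d : ℕ} (ξ : Rd d) (θ : Fin d → ℂ) :
    ContDiff ℝ 1 (expKernel ξ θ) := by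
  unfold expKernel
  refine Complex.contDiff_exp.comp (contDiff_const.mul (ContDiff.sum fun j _ => ?_))
  refine contDiff_const.mul (Complex.ofRealCLM.contDiff.comp ?_)
  exact ((EuclideanSpace.proj j : Rd d →L[ℝ] ℝ).contDiff).sub contDiff_const

@[fun_prop]
lemma continuous_expKernel {d : ℕ} (ξ : Rd d) (θ : Fin d → ℂ) :
    Continuous (expKernel ξ θ) := (contDiff_expKernel ξ θ).continuous

lemma hasLineDerivAt_expKernel {d : ℕ} (ξ : Rd d) (θ : Fin d → ℂ) (j : Fin d) (x : Rd d) :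
    HasLineDerivAt ℝ (expKernel ξ θ) (Complex.I * θ j * expKernel ξ θ x) x
      (EuclideanSpace.single j 1) := by
  have key (t : ℝ) : expKernel ξ θ (x + t • EuclideanSpace.single j (1 : ℝ)) =
      Complex.exp (Complex.I * ∑ k, θ k * ((x k - ξ k : ℝ) : ℂ) + Complex.I * θ j * t) := by
    unfold expKernel
    congr 1
    have (k : Fin d) : θ k * (((x + t • EuclideanSpace.single j (1 : ℝ)) k - ξ k : ℝ) : ℂ) =
        θ k * ((x k - ξ k : ℝ) : ℂ) + if k = j then θ j * t else 0 := by
      split_ifs with h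
      · subst h; simp; ring
      · simp [h]
    simp_rw [this, Finset.sum_add_distrib]
    simp
    ring
  rw [HasLineDerivAt]
  simp_rw [key]
  have h1 : HasDerivAt (fun t : ℝ => Complex.I * ∑ k, θ k * ((x k - ξ k : ℝ) : ℂ) +
      Complex.I * θ j * (t : ℂ)) (Complex.I * θ j) 0 := by
    have := ((Complex.ofRealCLM.hasDerivAt (x := (0 : ℝ))).const_mul
      (Complex.I * θ j)).const_add (Complex.I * ∑ k, θ k * ((x k - ξ k : ℝ) : ℂ))
    simpa using this
  have h2 := h1.cexp
  convert! h2 using 1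
  simp [expKernel, mul_comm]

/-- The Fourier–Laplace transform `∫ φ(x) exp(i θ·(x - ξ)) dx`, for a complex frequency `θ`. -/
noncomputable def laplace {d : ℕ} (ξ : Rd d) (φ : TestFun d) (θ : Fin d → ℂ) : ℂ :=
  ∫ x, expKernel ξ θ x * φ x

lemma integrable_continuous_mul {d : ℕ} (φ : TestFun d) {f : Rd d → ℂ} (hf : Continuous f) :
    Integrable (fun x => f x * φ x) :=
  (hf.mul φ.continuous).integrable_of_hasCompactSupport φ.hasCompactSupport.mul_left

lemma laplace_add {d : ℕ} (ξ : Rd d) (φ ψ : TestFun d) (θ : Fin d → ℂ) :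
    laplace ξ (φ + ψ) θ = laplace ξ φ θ + laplace ξ ψ θ := by
  unfold laplace
  rw [← integral_add (integrable_continuous_mul φ (continuous_expKernel ξ θ))
    (integrable_continuous_mul ψ (continuous_expKernel ξ θ))]
  simp [mul_add]

lemma laplace_smul {d : ℕ} (ξ : Rd d) (c : ℂ) (φ : TestFun d) (θ : Fin d → ℂ) :
    laplace ξ (c • φ) θ = c * laplace ξ φ θ := by
  unfold laplace
  rw [← integral_const_mul]
  simp [mul_left_comm]

/-- `T_j = i ∂_j`, the transpose of `D_j`, acting on test functions. -/
noncomputable def transposeD {d : ℕ} (j : Fin d) : Module.End ℂ (TestFun d) :=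
  Complex.I • (partialDeriv j : TestFun d →ₗ[ℂ] TestFun d)

lemma transposeD_apply {d : ℕ} (j : Fin d) (φ : TestFun d) :
    transposeD j φ = Complex.I • partialDeriv j φ := rfl

lemma laplace_transposeD {d : ℕ} (ξ : Rd d) (j : Fin d) (φ : TestFun d) (θ : Fin d → ℂ) :
    laplace ξ (transposeD j φ) θ = θ j * laplace ξ φ θ := by
  have hker : (fun x => fderiv ℝ (expKernel ξ θ) x (EuclideanSpace.single j 1)) =
      fun x => Complex.I * θ j * expKernel ξ θ x := by
    ext x
    rw [← (hasLineDerivAt_expKernel ξ θ j x).lineDeriv]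
    exact (((contDiff_expKernel ξ θ).differentiable one_ne_zero).differentiableAt.lineDeriv_eq_fderiv
      ).symm
  have hparts := integral_mul_fderiv_eq_neg_fderiv_mul_of_integrable (μ := volume)
    (f := expKernel ξ θ) (g := φ) (v := EuclideanSpace.single j (1 : ℝ))
    (by
      simp_rw [congrFun hker]
      exact integrable_continuous_mul φ (by fun_prop))
    (by
      simp_rw [← partialDeriv_apply]
      exact integrable_continuous_mul _ (continuous_expKernel ξ θ))
    (integrable_continuous_mul φ (continuous_expKernel ξ θ))
    (fun x _ => ((contDiff_expKernel ξ θ).differentiable one_ne_zero).differentiableAt)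
    (fun x _ => (φ.contDiff.differentiable (by simp)).differentiableAt)
  rw [transposeD_apply, laplace_smul, laplace]
  simp_rw [partialDeriv_apply]
  rw [hparts]
  simp_rw [congrFun hker, mul_assoc, integral_const_mul]
  rw [laplace]
  linear_combination (-θ j * ∫ x, expKernel ξ θ x * φ x) * Complex.I_mul_I

lemma laplace_transposeD_pow {d : ℕ} (ξ : Rd d) (j : Fin d) (n : ℕ) (φ : TestFun d)
    (θ : Fin d → ℂ) :
    laplace ξ ((transposeD j ^ n) φ) θ = θ j ^ n * laplace ξ φ θ := by
  induction n with
  | zero => simp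
  | succ n ih =>
    rw [pow_succ', Module.End.mul_apply, laplace_transposeD, ih]
    ring

lemma transposeD_pow_apply {d : ℕ} (j : Fin d) (n : ℕ) (φ : TestFun d) :
    (transposeD j ^ n) φ = Complex.I ^ n • (partialDeriv j ^ n) φ := by
  induction n with
  | zero => simp
  | succ n ih =>
    rw [pow_succ', Module.End.mul_apply, ih, map_smul, transposeD_apply, smul_smul, pow_succ,
      pow_succ' (partialDeriv j)]
    rfl

/-! ### Constant-coefficient operators on test functions -/

/-- `T^α`, the transpose of `D^α`; the factors appear in the reverse of the order used for
`distMultiD`. -/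
noncomputable def transposeMultiD {d : ℕ} (α : Fin d →₀ ℕ) : Module.End ℂ (TestFun d) :=
  ((List.finRange d).map fun j => transposeD j ^ α j).reverse.prod

/-- `P(T)`, the transpose of `P(D)`. -/
noncomputable def transposePolyD {d : ℕ} (P : MvPolynomial (Fin d) ℂ) :
    Module.End ℂ (TestFun d) :=
  ∑ α ∈ P.support, P.coeff α • transposeMultiD α

lemma distD_pow_apply {d : ℕ} (j : Fin d) (n : ℕ) (E : Distr d) (φ : TestFun d) :
    (distD j ^ n) E φ = E ((transposeD j ^ n) φ) := by
  induction n generalizing φ with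
  | zero => simp
  | succ n ih =>
    rw [pow_succ', Module.End.mul_apply, pow_succ, Module.End.mul_apply, ← ih, transposeD_apply,
      map_smul]
    simp [distD]

lemma distMultiD_apply {d : ℕ} (α : Fin d →₀ ℕ) (E : Distr d) (φ : TestFun d) :
    distMultiD α E φ = E (transposeMultiD α φ) := by
  unfold distMultiD transposeMultiD
  induction List.finRange d generalizing φ with
  | nil => simp
  | cons j l ih =>
    simp only [List.map_cons, List.prod_cons, List.reverse_cons, List.prod_append,
      List.prod_nil, mul_one, Module.End.mul_apply]
    rw [distD_pow_apply, ih]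

lemma polyD_apply {d : ℕ} (P : MvPolynomial (Fin d) ℂ) (E : Distr d) (φ : TestFun d) :
    polyD P E φ = E (transposePolyD P φ) := by
  simp only [polyD, transposePolyD, LinearMap.sum_apply, LinearMap.smul_apply, map_sum, map_smul]
  rw [sum_apply]
  simp [distMultiD_apply]

lemma laplace_transposeMultiD {d : ℕ} (ξ : Rd d) (α : Fin d →₀ ℕ) (φ : TestFun d)
    (θ : Fin d → ℂ) :
    laplace ξ (transposeMultiD α φ) θ = (∏ j, θ j ^ α j) * laplace ξ φ θ := by
  have h : (∏ j, θ j ^ α j) = ((List.finRange d).map fun j => θ j ^ α j).prod := by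
    rw [← List.ofFn_eq_map, List.prod_ofFn]
  rw [h, transposeMultiD]
  induction List.finRange d generalizing φ with
  | nil => simp
  | cons j l ih =>
    simp only [List.map_cons, List.prod_cons, List.reverse_cons, List.prod_append,
      List.prod_nil, mul_one, Module.End.mul_apply]
    rw [ih, laplace_transposeD_pow]
    ring

lemma laplace_transposePolyD {d : ℕ} (ξ : Rd d) (P : MvPolynomial (Fin d) ℂ) (φ : TestFun d)
    (θ : Fin d → ℂ) :
    laplace ξ (transposePolyD P φ) θ = MvPolynomial.eval θ P * laplace ξ φ θ := by
  classical
  rw [transposePolyD, MvPolynomial.eval_eq', LinearMap.sum_apply, Finset.sum_mul]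
  induction P.support using Finset.induction_on with
  | empty => simp [laplace]
  | insert a s ha ih =>
    rw [Finset.sum_insert ha, Finset.sum_insert ha, laplace_add, ih, LinearMap.smul_apply,
      laplace_smul, laplace_transposeMultiD, mul_assoc]

/-! ### Estimates and inversion on shifted frequency spaces -/

/-- The complex frequency `2πω - i s`, as `ω` runs through `ℝ^d`. -/
noncomputable def freq {d : ℕ} (s : Fin d → ℝ) (ω : Rd d) (j : Fin d) : ℂ :=
  2 * Real.pi * ω j - Complex.I * s j

lemma conj_freq {d : ℕ} (s : Fin d → ℝ) (ω : Rd d) (j : Fin d) :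
    starRingEnd ℂ (freq s ω j) = freq s ω j + 2 * Complex.I * s j := by
  simp only [freq, map_sub, map_mul, map_ofNat, Complex.conj_ofReal, Complex.conj_I]
  ring

lemma abs_le_norm_freq {d : ℕ} (s : Fin d → ℝ) (ω : Rd d) (j : Fin d) :
    |ω j| ≤ ‖freq s ω j‖ := by
  have h := Complex.abs_re_le_norm (freq s ω j)
  have h2 : (freq s ω j).re = 2 * Real.pi * ω j := by simp [freq]
  rw [h2, abs_mul, abs_of_pos Real.two_pi_pos] at h
  nlinarith [Real.pi_gt_three, abs_nonneg (ω j)]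

lemma expKernel_freq {d : ℕ} (ξ : Rd d) (s : Fin d → ℝ) (ω x : Rd d) :
    expKernel ξ (freq s ω) x =
      Complex.exp (((2 * Real.pi * inner ℝ x ω : ℝ) : ℂ) * Complex.I) *
      Complex.exp (-((2 * Real.pi * inner ℝ ω ξ : ℝ) : ℂ) * Complex.I) *
      Complex.exp ((∑ j, s j * (x j - ξ j) : ℝ) : ℂ) := by
  unfold expKernel
  rw [← Complex.exp_add, ← Complex.exp_add]
  congr 1
  simp only [PiLp.inner_apply, RCLike.inner_apply, conj_trivial]
  push_cast
  simp only [Finset.mul_sum, Finset.sum_mul, ← Finset.sum_neg_distrib, ← Finset.sum_add_distrib]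
  refine Finset.sum_congr rfl fun j _ => ?_
  simp only [freq]
  linear_combination (-s j * (x j - ξ j) : ℂ) * Complex.I_mul_I

lemma norm_expKernel_freq {d : ℕ} (ξ : Rd d) (s : Fin d → ℝ) (ω x : Rd d) :
    ‖expKernel ξ (freq s ω) x‖ = Real.exp (∑ j, s j * (x j - ξ j)) := by
  rw [expKernel_freq, norm_mul, norm_mul, Complex.norm_exp_ofReal_mul_I, ← Complex.ofReal_neg,
    Complex.norm_exp_ofReal_mul_I, ← Complex.ofReal_exp, Complex.norm_real, Real.norm_eq_abs,
    abs_of_pos (Real.exp_pos _)]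
  ring

/-- The function `x ↦ exp(s·(x - ξ)) φ(x)`. Up to a unimodular factor, its inverse Fourier transform
is the restriction of the Fourier–Laplace transform of `φ` to the frequencies `freq s`. -/
noncomputable def expTwist {d : ℕ} (ξ : Rd d) (s : Fin d → ℝ) (φ : TestFun d) (x : Rd d) : ℂ :=
  Complex.exp ((∑ j, s j * (x j - ξ j) : ℝ) : ℂ) * φ x

lemma continuous_expTwist {d : ℕ} (ξ : Rd d) (s : Fin d → ℝ) (φ : TestFun d) :
    Continuous (expTwist ξ s φ) := by
  unfold expTwist
  fun_prop

lemma integrable_expTwist {d : ℕ} (ξ : Rd d) (s : Fin d → ℝ) (φ : TestFun d) :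
    Integrable (expTwist ξ s φ) :=
  integrable_continuous_mul φ (by fun_prop)

lemma laplace_freq {d : ℕ} (ξ : Rd d) (s : Fin d → ℝ) (φ : TestFun d) (ω : Rd d) :
    laplace ξ φ (freq s ω) =
      Complex.exp (-((2 * Real.pi * inner ℝ ω ξ : ℝ) : ℂ) * Complex.I) *
        FourierTransformInv.fourierInv (expTwist ξ s φ) ω := by
  rw [Real.fourierInv_eq', laplace, ← integral_const_mul]
  refine integral_congr_ae (Filter.Eventually.of_forall fun x => ?_)
  simp only [expKernel_freq, expTwist, smul_eq_mul]
  ring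

lemma continuous_fourierInv_expTwist {d : ℕ} (ξ : Rd d) (s : Fin d → ℝ) (φ : TestFun d) :
    Continuous (FourierTransformInv.fourierInv (expTwist ξ s φ)) := by
  have h : Continuous (FourierTransform.fourier (expTwist ξ s φ)) :=
    VectorFourier.fourierIntegral_continuous Real.continuous_fourierChar
      (innerSL ℝ).continuous₂ (integrable_expTwist ξ s φ)
  have : FourierTransformInv.fourierInv (expTwist ξ s φ) =
      fun ω => FourierTransform.fourier (expTwist ξ s φ) (-ω) :=
    funext fun ω => Real.fourierInv_eq_fourier_neg _ _
  rw [this]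
  exact h.comp continuous_neg

lemma continuous_laplace_freq {d : ℕ} (ξ : Rd d) (s : Fin d → ℝ) (φ : TestFun d) :
    Continuous fun ω => laplace ξ φ (freq s ω) := by
  have := continuous_fourierInv_expTwist ξ s φ
  simp_rw [laplace_freq]
  fun_prop

lemma norm_laplace_le {d : ℕ} (ξ : Rd d) {φ : TestFun d} {L : Set (Rd d)} (hL : IsCompact L)
    (hφ : tsupport φ ⊆ L) {s : Fin d → ℝ} {W M : ℝ}
    (hW : ∀ x ∈ L, Real.exp (∑ j, s j * (x j - ξ j)) ≤ W) (hM : ∀ x, ‖φ x‖ ≤ M) (ω : Rd d) :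
    ‖laplace ξ φ (freq s ω)‖ ≤ W * M * volume.real L := by
  rw [laplace, ← setIntegral_eq_integral_of_forall_compl_eq_zero (s := L)]
  · refine norm_setIntegral_le_of_norm_le_const hL.measure_lt_top fun x hx => ?_
    rw [norm_mul, norm_expKernel_freq]
    exact mul_le_mul (hW x hx) (hM x) (norm_nonneg _) ((Real.exp_pos _).le.trans (hW x hx))
  · intro x hx
    rw [image_eq_zero_of_notMem_tsupport (fun h => hx (hφ h)), mul_zero]

lemma one_add_norm_pow_le {d : ℕ} (ω : Rd d) :
    (1 + ‖ω‖) ^ (d + 1) ≤ 2 ^ d * (1 + d ^ d * ∑ j, |ω j| ^ (d + 1)) := by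
  have h1 : ‖ω‖ ≤ ∑ j, |ω j| := by
    conv_lhs => rw [← (EuclideanSpace.basisFun (Fin d) ℝ).sum_repr ω]
    refine (norm_sum_le _ _).trans (le_of_eq ?_)
    simp [norm_smul]
  have h2 : (∑ j, |ω j|) ^ (d + 1) ≤ d ^ d * ∑ j, |ω j| ^ (d + 1) := by
    have := pow_sum_div_card_le_sum_pow (s := Finset.univ) (f := fun j => |ω j|)
      (fun j _ => abs_nonneg _) d
    rw [Finset.card_univ, Fintype.card_fin] at this
    rwa [div_le_iff₀' (by rcases d.eq_zero_or_pos with rfl | h <;> positivity)] at this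
  calc (1 + ‖ω‖) ^ (d + 1) ≤ (1 + ∑ j, |ω j|) ^ (d + 1) := by gcongr
    _ ≤ 2 ^ d * (1 ^ (d + 1) + (∑ j, |ω j|) ^ (d + 1)) :=
        add_pow_le zero_le_one (Finset.sum_nonneg fun j _ => abs_nonneg _) _
    _ ≤ _ := by rw [one_pow]; gcongr

/-- Control of `φ` and its pure derivatives of order `d + 1` makes the Fourier–Laplace transform
decay like `(1 + |ω|)^{-(d+1)}`, which is integrable over `ℝ^d`. No constant depends on the shift
`s`, which enters only through the bound `W` for the exponential weight. -/
lemma norm_laplace_le_decay {d : ℕ} (ξ : Rd d) {φ : TestFun d} {L : Set (Rd d)}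
    (hL : IsCompact L) (hφ : tsupport φ ⊆ L) {s : Fin d → ℝ} {W M : ℝ}
    (hW : ∀ x ∈ L, Real.exp (∑ j, s j * (x j - ξ j)) ≤ W) (hM : ∀ x, ‖φ x‖ ≤ M)
    (hM' : ∀ j x, ‖(partialDeriv j ^ (d + 1)) φ x‖ ≤ M) (ω : Rd d) :
    ‖laplace ξ φ (freq s ω)‖ ≤
      2 ^ d * (1 + d ^ d * d) * (W * M * volume.real L) * (1 + ‖ω‖) ^ (-(d + 1 : ℝ)) := by
  have h0 := norm_laplace_le ξ hL hφ hW hM ω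
  have hj (j : Fin d) :
      |ω j| ^ (d + 1) * ‖laplace ξ φ (freq s ω)‖ ≤ W * M * volume.real L := by
    have h1 : ‖laplace ξ ((transposeD j ^ (d + 1)) φ) (freq s ω)‖ ≤ W * M * volume.real L := by
      rw [transposeD_pow_apply, laplace_smul, norm_mul, norm_pow, Complex.norm_I, one_pow, one_mul]
      exact norm_laplace_le ξ hL ((tsupport_partialDeriv_pow_subset j _ φ).trans hφ) hW (hM' j) ω
    rw [laplace_transposeD_pow, norm_mul, norm_pow] at h1
    refine le_trans ?_ h1
    gcongr
    exact abs_le_norm_freq s ω j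
  have hpos : 0 < 1 + ‖ω‖ := by positivity
  have hr : (1 + ‖ω‖) ^ (-(d + 1 : ℝ)) = ((1 + ‖ω‖) ^ (d + 1))⁻¹ := by
    rw [Real.rpow_neg hpos.le, ← Real.rpow_natCast]
    push_cast
    rfl
  rw [hr, ← div_eq_mul_inv, le_div_iff₀ (by positivity)]
  calc ‖laplace ξ φ (freq s ω)‖ * (1 + ‖ω‖) ^ (d + 1)
      ≤ ‖laplace ξ φ (freq s ω)‖ * (2 ^ d * (1 + d ^ d * ∑ j, |ω j| ^ (d + 1))) := by
        gcongr
        exact one_add_norm_pow_le ω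
    _ = 2 ^ d * (‖laplace ξ φ (freq s ω)‖ +
          d ^ d * ∑ j, |ω j| ^ (d + 1) * ‖laplace ξ φ (freq s ω)‖) := by
        rw [← Finset.sum_mul]; ring
    _ ≤ 2 ^ d * (W * M * volume.real L + d ^ d * ∑ _j : Fin d, W * M * volume.real L) := by
        have := Finset.sum_le_sum fun j (_ : j ∈ Finset.univ) => hj j
        gcongr
    _ = _ := by simp; ring

lemma integrable_decay (d : ℕ) :
    Integrable fun ω : Rd d => (1 + ‖ω‖) ^ (-(d + 1 : ℝ)) := by
  apply integrable_one_add_norm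
  simp

/-- A test function and its derivatives of a given order are bounded, and the exponential weight
is bounded on the support. -/
lemma exists_decay_bound {d : ℕ} (ξ : Rd d) (s : Fin d → ℝ) (φ : TestFun d) :
    ∃ A : ℝ, ∀ ω, ‖laplace ξ φ (freq s ω)‖ ≤ A * (1 + ‖ω‖) ^ (-(d + 1 : ℝ)) := by
  obtain ⟨W, hW⟩ := φ.hasCompactSupport.isCompact.exists_bound_of_continuousOn
    (f := fun x : Rd d => Real.exp (∑ j, s j * (x j - ξ j))) (by fun_prop)
  have hb (ψ : TestFun d) : ∃ M, ∀ x, ‖ψ x‖ ≤ M :=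
    ψ.continuous.bounded_above_of_compact_support ψ.hasCompactSupport
  obtain ⟨M, hM⟩ := hb φ
  choose N hN using fun j => hb ((partialDeriv j ^ (d + 1)) φ)
  have hN0 (j : Fin d) : 0 ≤ N j := (norm_nonneg _).trans (hN j 0)
  have hM0 : 0 ≤ M := (norm_nonneg _).trans (hM 0)
  refine ⟨_, norm_laplace_le_decay ξ (M := M + ∑ j, N j) φ.hasCompactSupport.isCompact
    subset_rfl (fun x hx => (le_abs_self _).trans (hW x hx)) (fun x => ?_) (fun j x => ?_)⟩
  · have := Finset.sum_nonneg fun j (_ : j ∈ Finset.univ) => hN0 j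
    linarith [hM x]
  · have := Finset.single_le_sum (fun j (_ : j ∈ Finset.univ) => hN0 j) (Finset.mem_univ j)
    linarith [hN j x]

lemma integrable_laplace_freq {d : ℕ} (ξ : Rd d) (s : Fin d → ℝ) (φ : TestFun d) :
    Integrable fun ω => laplace ξ φ (freq s ω) := by
  obtain ⟨A, hA⟩ := exists_decay_bound ξ s φ
  exact ((integrable_decay d).const_mul A).mono'
    (continuous_laplace_freq ξ s φ).aestronglyMeasurable (Filter.Eventually.of_forall hA)

/-- Fourier inversion: the mean of the Fourier–Laplace transform over any shifted frequency space
recovers the value at the centre. -/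
lemma integral_laplace_freq {d : ℕ} (ξ : Rd d) (s : Fin d → ℝ) (φ : TestFun d) :
    ∫ ω, laplace ξ φ (freq s ω) = φ ξ := by
  have hint : Integrable (FourierTransformInv.fourierInv (expTwist ξ s φ)) := by
    refine (integrable_laplace_freq ξ s φ).norm.mono'
      (continuous_fourierInv_expTwist ξ s φ).aestronglyMeasurable
      (Filter.Eventually.of_forall fun ω => ?_)
    rw [laplace_freq, norm_mul, ← Complex.ofReal_neg, Complex.norm_exp_ofReal_mul_I, one_mul]
  have hint' : Integrable (FourierTransform.fourier (expTwist ξ s φ)) := by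
    have := hint.comp_neg
    simpa [Real.fourierInv_eq_fourier_neg] using this
  have h := congrFun ((continuous_expTwist ξ s φ).fourier_fourierInv_eq
    (integrable_expTwist ξ s φ) hint') ξ
  rw [Real.fourier_eq'] at h
  calc ∫ ω, laplace ξ φ (freq s ω) = expTwist ξ s φ ξ := by
        rw [← h]
        refine integral_congr_ae (Filter.Eventually.of_forall fun ω => ?_)
        simp only [laplace_freq, smul_eq_mul]
        congr 3
        push_cast
        ring
    _ = φ ξ := by simp [expTwist]

/-! ### The building blocks of the fundamental solution -/

/-- The unimodular quotient `conj P(θ) / P(θ)`, with the value `0` at the zeros of `P`. -/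
noncomputable def phase {d : ℕ} (P : MvPolynomial (Fin d) ℂ) (θ : Fin d → ℂ) : ℂ :=
  starRingEnd ℂ (MvPolynomial.eval θ P) / MvPolynomial.eval θ P

lemma norm_phase_le {d : ℕ} (P : MvPolynomial (Fin d) ℂ) (θ : Fin d → ℂ) : ‖phase P θ‖ ≤ 1 := by
  rw [phase, norm_div, RCLike.norm_conj]
  exact div_self_le_one _

lemma phase_mul_eval {d : ℕ} (P : MvPolynomial (Fin d) ℂ) (θ : Fin d → ℂ) :
    phase P θ * MvPolynomial.eval θ P = starRingEnd ℂ (MvPolynomial.eval θ P) := by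
  -- at a zero of `P` both sides vanish, so no exceptional set arises
  by_cases h : MvPolynomial.eval θ P = 0
  · simp [h]
  · rw [phase, div_mul_cancel₀ _ h]

lemma measurable_phase_freq {d : ℕ} (P : MvPolynomial (Fin d) ℂ) (s : Fin d → ℝ) :
    Measurable fun ω : Rd d => phase P (freq s ω) := by
  have h : Continuous fun ω : Rd d => MvPolynomial.eval (freq s ω) P := by
    refine (MvPolynomial.continuous_eval P).comp (continuous_pi fun j => ?_)
    unfold freq
    fun_prop
  unfold phase
  exact (Complex.continuous_conj.comp h).measurable.div h.measurable

lemma integrable_phase_mul_laplace {d : ℕ} (ξ : Rd d) (P : MvPolynomial (Fin d) ℂ)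
    (s : Fin d → ℝ) (φ : TestFun d) :
    Integrable fun ω => phase P (freq s ω) * laplace ξ φ (freq s ω) :=
  (integrable_laplace_freq ξ s φ).bdd_mul (measurable_phase_freq P s).aestronglyMeasurable
    (Filter.Eventually.of_forall fun _ => norm_phase_le P _)

/-- The total mass of the decay bound in `norm_laplace_le_decay`. -/
noncomputable def decayConst (d : ℕ) : ℝ :=
  2 ^ d * (1 + d ^ d * d) * ∫ ω : Rd d, (1 + ‖ω‖) ^ (-(d + 1 : ℝ))

lemma decayConst_nonneg (d : ℕ) : 0 ≤ decayConst d := by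
  have : 0 ≤ ∫ ω : Rd d, (1 + ‖ω‖) ^ (-(d + 1 : ℝ)) :=
    integral_nonneg fun ω => by positivity
  unfold decayConst
  positivity

lemma norm_integral_phase_mul_laplace_le {d : ℕ} (ξ : Rd d) (P : MvPolynomial (Fin d) ℂ)
    {φ : TestFun d} {L : Set (Rd d)} (hL : IsCompact L) (hφ : tsupport φ ⊆ L) {s : Fin d → ℝ}
    {W M : ℝ} (hW : ∀ x ∈ L, Real.exp (∑ j, s j * (x j - ξ j)) ≤ W) (hM : ∀ x, ‖φ x‖ ≤ M)
    (hM' : ∀ j x, ‖(partialDeriv j ^ (d + 1)) φ x‖ ≤ M) :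
    ‖∫ ω, phase P (freq s ω) * laplace ξ φ (freq s ω)‖ ≤
      decayConst d * (W * M * volume.real L) := by
  refine (norm_integral_le_of_norm_le ((integrable_decay d).const_mul
    (2 ^ d * (1 + d ^ d * d) * (W * M * volume.real L)))
    (Filter.Eventually.of_forall fun ω => ?_)).trans (le_of_eq ?_)
  · rw [norm_mul]
    exact (mul_le_of_le_one_left (norm_nonneg _) (norm_phase_le P _)).trans
      (norm_laplace_le_decay ξ hL hφ hW hM hM' ω)
  · rw [integral_const_mul, decayConst]
    ring

/-- The distribution `φ ↦ ∫ (conj P / P)(θ) Φ(θ) dω` along `θ = freq s ω`, where `Φ` is the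
Fourier–Laplace transform of `φ`. -/
noncomputable def phaseDistr {d : ℕ} (ξ : Rd d) (P : MvPolynomial (Fin d) ℂ) (s : Fin d → ℝ) :
    Distr d :=
  TestFunction.mkCLM ℂ (fun φ => ∫ ω, phase P (freq s ω) * laplace ξ φ (freq s ω))
    (fun φ ψ => by
      rw [← integral_add (integrable_phase_mul_laplace ξ P s φ)
        (integrable_phase_mul_laplace ξ P s ψ)]
      simp_rw [laplace_add, mul_add])
    (fun c φ => by
      rw [smul_eq_mul, ← integral_const_mul]
      simp_rw [laplace_smul, mul_left_comm])
    (fun K hK => by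
      obtain ⟨W, hW⟩ := K.isCompact.exists_bound_of_continuousOn
        (f := fun x : Rd d => Real.exp (∑ j, s j * (x j - ξ j))) (by fun_prop)
      let ι := TestFunction.ofSupportedInCLM ℂ hK (n := ⊤) (F := ℂ)
      let β : TestFun d →L[ℂ] BoundedContinuousFunction (Rd d) ℂ :=
        TestFunction.toBoundedContinuousFunctionCLM ℂ
      let N (f : TestFun d) : ℝ := ‖β f‖ + ∑ j, ‖β ((partialDeriv j ^ (d + 1)) f)‖
      have hN : Continuous fun f => N (ι f) := by fun_prop
      have hle (f : TestFun d) (hf : tsupport f ⊆ K) :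
          ‖∫ ω, phase P (freq s ω) * laplace ξ f (freq s ω)‖ ≤
            decayConst d * (W * N f * volume.real (K : Set (Rd d))) := by
        refine norm_integral_phase_mul_laplace_le ξ P K.isCompact hf
          (fun x hx => (le_abs_self _).trans (hW x hx)) (fun x => ?_) (fun j x => ?_)
        · refine ((β f).norm_coe_le_norm x).trans (le_add_of_nonneg_right ?_)
          exact Finset.sum_nonneg fun j _ => norm_nonneg _
        · refine ((β ((partialDeriv j ^ (d + 1)) f)).norm_coe_le_norm x).trans ?_
          refine le_trans ?_ (le_add_of_nonneg_left (norm_nonneg _))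
          exact Finset.single_le_sum (f := fun j => ‖β ((partialDeriv j ^ (d + 1)) f)‖)
            (fun j _ => norm_nonneg _) (Finset.mem_univ j)
      let T : ContDiffMapSupportedIn (Rd d) ℂ ⊤ K →+ ℂ :=
        { toFun := fun f => ∫ ω, phase P (freq s ω) * laplace ξ (ι f) (freq s ω)
          map_zero' := by simp [laplace]
          map_add' := fun f g => by
            rw [← integral_add (integrable_phase_mul_laplace ξ P s _)
              (integrable_phase_mul_laplace ξ P s _)]
            simp_rw [map_add, laplace_add, mul_add] }
      refine continuous_of_continuousAt_zero T ?_
      rw [ContinuousAt, map_zero]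
      refine squeeze_zero_norm (fun f => hle (ι f) f.tsupport_subset) ?_
      have hcont : Continuous fun f =>
          decayConst d * (W * N (ι f) * volume.real (K : Set (Rd d))) := by fun_prop
      have := hcont.tendsto 0
      simpa [N] using this)

lemma phaseDistr_apply {d : ℕ} (ξ : Rd d) (P : MvPolynomial (Fin d) ℂ) (s : Fin d → ℝ)
    (φ : TestFun d) :
    phaseDistr ξ P s φ = ∫ ω, phase P (freq s ω) * laplace ξ φ (freq s ω) := rfl

/-! ### The dual norms -/

lemma norm_multiDeriv_le_one {d : ℕ} {L : Set (Rd d)} {N : ℕ} {φ : TestFun d}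
    (h : cnorm L N φ ≤ 1) {α : Fin d →₀ ℕ} (hα : ∑ j, α j ≤ N) {x : Rd d} (hx : x ∈ L) :
    ‖multiDeriv α φ x‖ ≤ 1 := by
  have h1 : ‖multiDeriv α φ x‖ₑ ≤ cnorm L N φ :=
    le_iSup₂_of_le x hx (le_iSup₂_of_le α hα le_rfl)
  have h2 := h1.trans h
  rwa [← ofReal_norm, ENNReal.ofReal_le_one] at h2

lemma multiDeriv_single {d : ℕ} (j : Fin d) (n : ℕ) :
    multiDeriv (Finsupp.single j n) = partialDeriv j ^ n := by
  rw [multiDeriv, List.prod_map_eq_pow_single j _ (fun k hk _ => by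
      rw [Finsupp.single_eq_of_ne hk, pow_zero]),
    List.count_eq_one_of_mem (List.nodup_finRange d) (List.mem_finRange j), pow_one,
    Finsupp.single_eq_same]

lemma dualNorm_le {d : ℕ} {L : Set (Rd d)} {N : ℕ} {E : Distr d} {B : ℝ}
    (h : ∀ φ : TestFun d, tsupport φ ⊆ L → cnorm L N φ ≤ 1 → ‖E φ‖ ≤ B) :
    dualNorm L N E ≤ ENNReal.ofReal B := by
  refine iSup_le fun φ => iSup₂_le fun h1 h2 => ?_
  rw [← ofReal_norm]
  exact ENNReal.ofReal_le_ofReal (h φ h1 h2)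

lemma norm_phaseDistr_le {d : ℕ} (ξ : Rd d) (P : MvPolynomial (Fin d) ℂ) {φ : TestFun d}
    {L : Set (Rd d)} (hL : IsCompact L) (hφ : tsupport φ ⊆ L) (hc : cnorm L (d + 1) φ ≤ 1)
    {s : Fin d → ℝ} {W : ℝ} (hW : ∀ x ∈ L, Real.exp (∑ j, s j * (x j - ξ j)) ≤ W) :
    ‖phaseDistr ξ P s φ‖ ≤ decayConst d * (W * volume.real L) := by
  have hex (ψ : TestFun d) (hψ : tsupport ψ ⊆ tsupport φ) (h : ∀ x ∈ L, ‖ψ x‖ ≤ 1) (x : Rd d) :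
      ‖ψ x‖ ≤ 1 := by
    by_cases hx : x ∈ L
    · exact h x hx
    · rw [image_eq_zero_of_notMem_tsupport (fun hx' => hx (hφ (hψ hx')))]
      simp
  have := norm_integral_phase_mul_laplace_le ξ P hL hφ hW (M := 1)
    (hex φ subset_rfl fun x hx => by
      simpa [multiDeriv] using norm_multiDeriv_le_one hc (α := 0) (by simp) hx)
    (fun j => hex _ (tsupport_partialDeriv_pow_subset j _ φ) fun x hx => by
      have := norm_multiDeriv_le_one hc (α := Finsupp.single j (d + 1))
        (by simp [Finsupp.single_apply, Finset.sum_add_distrib]) hx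
      rwa [multiDeriv_single] at this)
  rwa [mul_one] at this

/-! ### The shifted fundamental solutions -/

/-- The principal part of `conj P` at `2iη`. -/
noncomputable def principalValue {d : ℕ} (P : MvPolynomial (Fin d) ℂ) (η : Fin d → ℝ) : ℂ :=
  MvPolynomial.eval (fun j => 2 * Complex.I * η j)
    (MvPolynomial.homogeneousComponent (MvPolynomial.map (starRingEnd ℂ) P).totalDegree
      (MvPolynomial.map (starRingEnd ℂ) P))

/-- The fundamental solution with pole `ξ` obtained from the shifts `(t + k) η`, `k = 0, …, m`,
where `m` is the degree of `P`. -/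
noncomputable def shiftedSol {d : ℕ} (ξ : Rd d) (P : MvPolynomial (Fin d) ℂ) (η : Fin d → ℝ)
    (t : ℝ) : Distr d :=
  (principalValue P η)⁻¹ • ∑ k ∈ Finset.range ((MvPolynomial.map (starRingEnd ℂ) P).totalDegree + 1),
    diffWeight (MvPolynomial.map (starRingEnd ℂ) P).totalDegree k •
      phaseDistr ξ P (fun j => (t + k) * η j)

/-- The polynomial `θ ↦ Q(θ + v)`. -/
noncomputable def translate {d : ℕ} (v : Fin d → ℂ) (Q : MvPolynomial (Fin d) ℂ) :
    MvPolynomial (Fin d) ℂ :=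
  MvPolynomial.bind₁ (fun j => MvPolynomial.X j + MvPolynomial.C (v j)) Q

lemma eval_translate {d : ℕ} (v θ : Fin d → ℂ) (Q : MvPolynomial (Fin d) ℂ) :
    MvPolynomial.eval θ (translate v Q) = MvPolynomial.eval (fun j => θ j + v j) Q := by
  have h : (MvPolynomial.eval θ).comp (MvPolynomial.bind₁ (R := ℂ)
        (fun j => MvPolynomial.X j + MvPolynomial.C (v j))).toRingHom =
      MvPolynomial.eval (fun j => θ j + v j) := by
    apply MvPolynomial.ringHom_ext <;> simp
  exact congrArg (fun f => f Q) h

/-- On the space `freq s`, complex conjugation of frequencies is a translation, so multiplying the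
phase by `P` turns the building block into a differential operator at the point `ξ`, which may be
evaluated by an integral over the unshifted space `freq 0`. -/
lemma phaseDistr_transposePolyD {d : ℕ} (ξ : Rd d) (P : MvPolynomial (Fin d) ℂ) (s : Fin d → ℝ)
    (φ : TestFun d) :
    phaseDistr ξ P s (transposePolyD P φ) =
      ∫ ω, laplace ξ (transposePolyD (translate (fun j => 2 * Complex.I * s j)
        (MvPolynomial.map (starRingEnd ℂ) P)) φ) (freq 0 ω) := by
  rw [integral_laplace_freq, ← integral_laplace_freq ξ s, phaseDistr_apply]
  refine integral_congr_ae (Filter.Eventually.of_forall fun ω => ?_)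
  simp only
  rw [laplace_transposePolyD, laplace_transposePolyD, ← mul_assoc, phase_mul_eval, eval_translate,
    ← eval_conj_map_conj]
  simp_rw [conj_freq]

lemma polyD_shiftedSol {d : ℕ} (ξ : Rd d) (P : MvPolynomial (Fin d) ℂ) {η : Fin d → ℝ}
    (hη : principalValue P η ≠ 0) (t : ℝ) : polyD P (shiftedSol ξ P η t) = dirac ξ := by
  ext φ
  change _ = φ ξ
  set Q := MvPolynomial.map (starRingEnd ℂ) P with hQ
  have h (ω : Rd d) : ∑ k ∈ Finset.range (Q.totalDegree + 1), diffWeight Q.totalDegree k *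
      laplace ξ (transposePolyD (translate (fun j => 2 * Complex.I * ((t + k) * η j : ℝ)) Q) φ)
        (freq 0 ω) = principalValue P η * laplace ξ φ (freq 0 ω) := by
    rw [principalValue, ← hQ, ← sum_diffWeight_mul_eval_line Q (freq 0 ω) _ t, Finset.sum_mul]
    refine Finset.sum_congr rfl fun k _ => ?_
    rw [laplace_transposePolyD, eval_translate, mul_assoc]
    congr 4
    ext j
    push_cast
    ring
  have hsum : ∑ k ∈ Finset.range (Q.totalDegree + 1), diffWeight Q.totalDegree k *
      phaseDistr ξ P (fun j => (t + k) * η j) (transposePolyD P φ) =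
        principalValue P η * φ ξ := by
    simp_rw [phaseDistr_transposePolyD, ← integral_const_mul]
    rw [← integral_finsetSum _ fun k _ => (integrable_laplace_freq ξ 0 _).const_mul _]
    rw [← integral_laplace_freq ξ 0 φ, ← integral_const_mul]
    exact integral_congr_ae (Filter.Eventually.of_forall h)
  rw [polyD_apply, shiftedSol, ← hQ]
  simp only [smul_apply, sum_apply, smul_eq_mul]
  rw [hsum, inv_mul_cancel_left₀ hη]

/-- The sum of the absolute values of the weights in `shiftedSol`. -/
noncomputable def weightConst {d : ℕ} (P : MvPolynomial (Fin d) ℂ) (η : Fin d → ℝ) : ℝ :=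
  ‖(principalValue P η)⁻¹‖ *
    ∑ k ∈ Finset.range ((MvPolynomial.map (starRingEnd ℂ) P).totalDegree + 1),
      ‖diffWeight (MvPolynomial.map (starRingEnd ℂ) P).totalDegree k‖

lemma dualNorm_shiftedSol_le {d : ℕ} (ξ : Rd d) (P : MvPolynomial (Fin d) ℂ) (η : Fin d → ℝ)
    (t : ℝ) {L : Set (Rd d)} (hL : IsCompact L) {W : ℝ}
    (hW : ∀ k ≤ (MvPolynomial.map (starRingEnd ℂ) P).totalDegree, ∀ x ∈ L,
      Real.exp ((t + k) * ∑ j, η j * (x j - ξ j)) ≤ W) :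
    dualNorm L (d + 1) (shiftedSol ξ P η t) ≤
      ENNReal.ofReal (weightConst P η * decayConst d * volume.real L * W) := by
  have hd := decayConst_nonneg d
  refine dualNorm_le fun φ hφ hc => ?_
  have hk (k : ℕ) (hk : k ∈ Finset.range
      ((MvPolynomial.map (starRingEnd ℂ) P).totalDegree + 1)) :
      ‖diffWeight (MvPolynomial.map (starRingEnd ℂ) P).totalDegree k •
        phaseDistr ξ P (fun j => (t + k) * η j) φ‖ ≤
      ‖diffWeight (MvPolynomial.map (starRingEnd ℂ) P).totalDegree k‖ *
        (decayConst d * (W * volume.real L)) := by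
    rw [norm_smul]
    gcongr
    refine norm_phaseDistr_le ξ P hL hφ hc fun x hx => ?_
    have := hW k (by simpa [Nat.lt_succ_iff] using hk) x hx
    simpa only [Finset.mul_sum, mul_assoc] using this
  have hs := norm_sum_le_of_le _ hk
  simp only [shiftedSol, smul_apply, sum_apply]
  rw [norm_smul]
  refine (mul_le_mul_of_nonneg_left hs (norm_nonneg _)).trans (le_of_eq ?_)
  rw [weightConst, ← Finset.sum_mul]
  ring

end ShiftedFS

/-! ### Choice of the shift -/

theorem lemma4p1 (d : ℕ) (P : MvPolynomial (Fin d) ℂ) (hP : P ≠ 0)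
    (K : Set (ShiftedFS.Rd d)) (hK : IsCompact K) (hKc : Convex ℝ K)
    (ξ : ShiftedFS.Rd d) (hξ : ξ ∉ K) :
    ∃ E : ℝ → ShiftedFS.Distr d,
      (∀ ε ∈ Set.Ioo (0 : ℝ) 1,
        ShiftedFS.polyD P (E ε) = ShiftedFS.dirac ξ ∧
        ShiftedFS.dualNorm K (d + 1) (E ε) ≤ ENNReal.ofReal ε) ∧
      ∀ L : Set (ShiftedFS.Rd d), IsCompact L → Convex ℝ L →
        ∃ s C : ℝ, 0 < s ∧ 0 < C ∧ ∀ ε ∈ Set.Ioo (0 : ℝ) 1,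
          ShiftedFS.dualNorm L (d + 1) (E ε) ≤ ENNReal.ofReal (C / ε ^ s) := by
  have hQ : MvPolynomial.map (starRingEnd ℂ) P ≠ 0 := by
    rwa [Ne, map_eq_zero_iff _ (MvPolynomial.map_injective _ (starRingEnd ℂ).injective)]
  obtain ⟨η, hη, c, hc, hηK⟩ := ShiftedFS.exists_separating_direction
    (ShiftedFS.homogeneousComponent_totalDegree_ne_zero hQ) hK hKc hξ
  set m := (MvPolynomial.map (starRingEnd ℂ) P).totalDegree with hm
  set A := ShiftedFS.weightConst P η * ShiftedFS.decayConst d with hA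
  have hA0 : 0 ≤ A := by
    have := ShiftedFS.decayConst_nonneg d
    rw [hA, ShiftedFS.weightConst]
    positivity
  set B := A * MeasureTheory.volume.real K + 1 with hB
  have hB1 : 1 ≤ B := by
    rw [hB]
    exact le_add_of_nonneg_left (by positivity)
  have hB0 : 0 < B := by linarith
  -- the shift is chosen so that the weight `exp (-t c)` on `K` equals `ε / B`
  set t : ℝ → ℝ := fun ε => Real.log (B / ε) / c with ht
  have ht0 {ε : ℝ} (hε : ε ∈ Set.Ioo (0 : ℝ) 1) : 0 ≤ t ε :=
    div_nonneg (Real.log_nonneg ((one_le_div hε.1).2 (hε.2.le.trans hB1))) hc.le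
  refine ⟨fun ε => ShiftedFS.shiftedSol ξ P η (t ε), fun ε hε => ⟨?_, ?_⟩, fun L hL _ => ?_⟩
  · exact ShiftedFS.polyD_shiftedSol ξ P hη _
  · have hBε : 0 < B / ε := div_pos hB0 hε.1
    refine (ShiftedFS.dualNorm_shiftedSol_le ξ P η (t ε) hK (W := ε / B)
      fun k _ x hx => ?_).trans (ENNReal.ofReal_le_ofReal ?_)
    · calc Real.exp ((t ε + k) * ∑ j, η j * (x j - ξ j))
          ≤ Real.exp (-Real.log (B / ε)) := by
            rw [Real.exp_le_exp]
            have h1 : t ε * c = Real.log (B / ε) := div_mul_cancel₀ _ hc.ne'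
            nlinarith [hηK x hx, ht0 hε, mul_nonneg (Nat.cast_nonneg (α := ℝ) k) hc.le,
              mul_le_mul_of_nonneg_left (hηK x hx)
                (add_nonneg (ht0 hε) (Nat.cast_nonneg (α := ℝ) k))]
        _ = ε / B := by rw [Real.exp_neg, Real.exp_log hBε, inv_div]
    · rw [mul_div_left_comm]
      refine mul_le_of_le_one_right hε.1.le ((div_le_one hB0).2 ?_)
      rw [hB]
      exact le_add_of_nonneg_right zero_le_one
  · obtain ⟨b₀, hb₀⟩ := hL.exists_bound_of_continuousOn
      (f := fun x : ShiftedFS.Rd d => ∑ j, η j * (x j - ξ j)) (by fun_prop)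
    set b := |b₀| + 1 with hb
    have hb0 : 0 < b := by positivity
    have hbL : ∀ x ∈ L, ∑ j, η j * (x j - ξ j) ≤ b := fun x hx => by
      linarith [(le_abs_self _).trans (hb₀ x hx), le_abs_self b₀]
    refine ⟨b / c, A * MeasureTheory.volume.real L * (B ^ (b / c) * Real.exp (m * b)) + 1,
      div_pos hb0 hc, by positivity, fun ε hε => ?_⟩
    have hBε : 0 < B / ε := div_pos hB0 hε.1
    refine (ShiftedFS.dualNorm_shiftedSol_le ξ P η (t ε) hL (W := (B / ε) ^ (b / c) *
      Real.exp (m * b)) fun k hk x hx => ?_).trans (ENNReal.ofReal_le_ofReal ?_)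
    · have hkm : (k : ℝ) ≤ m := by exact_mod_cast hk
      rw [Real.rpow_def_of_pos hBε, ← Real.exp_add, Real.exp_le_exp]
      calc (t ε + k) * ∑ j, η j * (x j - ξ j) ≤ (t ε + k) * b :=
            mul_le_mul_of_nonneg_left (hbL x hx) (add_nonneg (ht0 hε) (Nat.cast_nonneg k))
        _ ≤ (t ε + m) * b := by gcongr
        _ = Real.log (B / ε) * (b / c) + m * b := by rw [ht]; ring
    · rw [Real.div_rpow hB0.le hε.1.le, ← hA, le_div_iff₀ (Real.rpow_pos_of_pos hε.1 _)]
      have hεs : ε ^ (b / c) ≠ 0 := (Real.rpow_pos_of_pos hε.1 _).ne'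
      calc _ = A * MeasureTheory.volume.real L * (B ^ (b / c) * Real.exp (m * b)) := by
            field_simp
        _ ≤ _ := le_add_of_nonneg_right zero_le_one
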